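/- **Conventions.** All structures are over relational languages, and $\mathbb N=\{1,2,\dots\}$. An embedding $\mathcal A\hookrightarrow\mathcal B$ is an injective map that preserves and reflects all relations; $\mathrm{Emb}(\mathcal A,\mathcal B)$ is the set of embeddings. $\mathrm{Age}(\mathcal F)$ is the class of finite structures that embed into $\mathcal F$. $\mathrm{Fin}(\mathcal F)$ is the category whose objects are the substructures of $\mathcal F$ induced on finite nonempty subsets and whose morphisms are the embeddings. A *Fraïssé limit* is a countably infinite ultrahomogeneous structure. * $\mathcal F$ has *finite big Ramsey degrees* if for each $\mathcal A\in\mathrm{Age}(\mathcal F)$ there is $n\in\mathbb N$ such that for all $k\in\mathbb N$ and all $\chi:\mathrm{Emb}(\mathcal A,\mathcal F)\to k$ there is $w\in\mathrm{Emb}(\mathcal F,\mathcal F)$ with $|\chi(w\circ\mathrm{Emb}(\mathcal A,\mathcal F))|\le n$. * $\mathcal F$ has *strongly amalgamable age* if for all $\mathcal A,\mathcal B,\mathcal C\in\mathrm{Age}(\mathcal F)$ and embeddings $f:\mathcal A\hookrightarrow\mathcal B$, $g:\mathcal A\hookrightarrow\mathcal C$ there are $\mathcal D\in\mathrm{Age}(\mathcal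 F)$ and embeddings $f':\mathcal B\hookrightarrow\mathcal D$, $g':\mathcal C\hookrightarrow\mathcal D$ with $f'\circ f=g'\circ g$ and $f'(B)\cap g'(C)=f'(f(A))$. * $\mathcal F$ (or $\mathrm{Fin}(\mathcal F)$) has *natural 1-point extensions* if there is a functor $J:\mathrm{Fin}(\mathcal F)\to\mathrm{Fin}(\mathcal F)$ such that, writing $A'$ for the underlying set of $J(\mathcal A)$, each $\mathcal A$ is a substructure of $J(\mathcal A)$ with $|A'\setminus A|=1$, and for every $f:\mathcal A\hookrightarrow\mathcal B$ in $\mathrm{Fin}(\mathcal F)$ we have $J(f)(a)=f(a)$ for $a\in A$ and $J(f)(A'\setminus A)=B'\setminus B$. * $\mathcal S$ is *approximable* in $\mathbf K=\mathrm{Fin}(\mathcal S)$ via $F$ and $(\Phi_{\mathcal A})_{\mathcal A\in\mathbf K}$ if $F$ is a mapping from objects of $\mathbf K$ to objects of $\mathbf K$ and $\Phi_{\mathcal A}:\mathrm{Emb}(F(\mathcal A),\mathcal S)\to\bigcup_{\mathcal C\in\mathbf K}\mathrm{Emb}(\mathcal A,\mathcal C)$ are maps (Borel, for the discrete topologies on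 the sets of embeddings) such that for all $\mathcal A,\mathcal B\in\mathbf K$, $f\in\mathrm{Emb}(\mathcal A,\mathcal B)$ and $u\in\mathrm{Emb}(F(\mathcal B),\mathcal S)$ there is $f'\in\mathrm{Emb}(F(\mathcal A),F(\mathcal B))$ with $\Phi_{\mathcal A}(u\circ f')=\Phi_{\mathcal B}(u)\circ f$. The union is disjoint, so the equality includes equality of codomains. $\mathcal S$ is *approximable* in $\mathbf K$ if it is so via some $F$ and $(\Phi_{\mathcal A})$. **Theorem (the $\star$-Ramsey property for enumerated Fraïssé limits).** Let $L$ be a relational language and $<\,\notin L$ a binary relation symbol. Let $\mathcal S=(S,L^S,<^S)$ be an enumerated $L$-structure, i.e. an $(L\cup\{<\})$-structure in which $(S,<^S)$ is a linear order of type $\omega$. Assume that $(S,L^S)$ is a Fraïssé limit with finite big Ramsey degrees, with strongly amalgamable age and with natural 1-point extensions. Let $\mathbf K=\mathrm{Fin}(\mathcal S)$. Then: (a) $\mathbf K$ has natural 1-point extensions. (b) $\mathcal S$ is approximable in $\mathbf K$. (c) Let $F$ and $(\Phi_{\mathcal A})_{\mathcal A\in\mathbf K}$ be any mapping and any family via which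 $\mathcal S$ is approximable in $\mathbf K$, and for each $\mathcal B\in\mathbf K$ let $\iota_{\mathcal B}:\mathcal B\hookrightarrow\mathcal S$ be an embedding. For $h\in\mathrm{Emb}(\mathcal S,\mathcal S)$ and $f\in\mathrm{Emb}(\mathcal A,\mathcal B)$ put $h\star f=\Phi_{\mathcal B}(h\circ\iota_{F(\mathcal B)})\circ f$. Then for every $\mathcal A\in\mathbf K$ there is $n\in\mathbb N$ such that for every $k\in\mathbb N$ and every coloring $\chi:\bigcup_{\mathcal B\in\mathbf K}\mathrm{Emb}(\mathcal A,\mathcal B)\to k$ there is $h\in\mathrm{Emb}(\mathcal S,\mathcal S)$ with $$\Big|\chi\Big(\bigcup_{\mathcal B\in\mathbf K}h\star\mathrm{Emb}(\mathcal A,\mathcal B)\Big)\Big|\le n.$$ -/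

import Mathlib

universe u v w

open FirstOrder CategoryTheory
open scoped FirstOrder Topology MeasureTheory

namespace EnumFraisse

/-! ### Adding a binary symbol `<` to a language -/

/-- The relation symbols of the language with one binary symbol `<`. -/
inductive LtRel : ℕ → Type
  | lt : LtRel 2

/-- The relational language whose only symbol is the binary relation symbol `<`. -/
def ltLanguage : FirstOrder.Language.{0, 0} := ⟨fun _ => Empty, LtRel⟩

/-- The language `L ∪ {<}`, where `<` is a new binary relation symbol. -/
abbrev withLt (L : FirstOrder.Language.{u, v}) : FirstOrder.Language.{u, v} := L.sum ltLanguage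

/-- A linear order interprets the symbol `<` by its strict order. Together with an `L`-structure
on `S` this makes `S` an `L ∪ {<}`-structure. -/
instance ltStructure (S : Type w) [LinearOrder S] : ltLanguage.Structure S where
  funMap := fun f => nomatch f
  RelMap := fun {_} r =>
    match r with
    | LtRel.lt => fun x => x 0 < x 1

/-! ### Fraïssé limits, strong amalgamation, big Ramsey degrees -/

/-- `M` is a Fraïssé limit (of its age): a countably infinite ultrahomogeneous structure. -/
structure IsFraisseLimitOfAge (L : FirstOrder.Language.{u, v}) (M : Type w) [L.Structure M] : Prop where
  countable : Countable M
  infinite : Infinite M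
  ultrahomogeneous : L.IsUltrahomogeneous M

/-- The strong amalgamation property of a class of structures. -/
def StrongAmalgamation {L : FirstOrder.Language.{u, v}} (K : Set (Bundled.{w} L.Structure)) : Prop :=
  ∀ (A B C : Bundled.{w} L.Structure) (f : A ↪[L] B) (g : A ↪[L] C),
    A ∈ K → B ∈ K → C ∈ K →
      ∃ (D : Bundled.{w} L.Structure) (f' : B ↪[L] D) (g' : C ↪[L] D),
        D ∈ K ∧ f'.comp f = g'.comp g ∧
          Set.range f' ∩ Set.range g' = Set.range (f'.comp f)

/-- The big (embedding) Ramsey degree of `A` in `M` is at most `n`: every finite coloring `χ` of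
`Emb(A, M)` takes at most `n` colors on `w ∘ Emb(A, M)` for some self-embedding `w` of `M`. -/
def BigRamseyDegreeLE (L : FirstOrder.Language.{u, v}) (A M : Type w) [L.Structure A] [L.Structure M]
    (n : ℕ) : Prop :=
  ∀ (k : ℕ) (χ : (A ↪[L] M) → Fin k), ∃ w : M ↪[L] M,
    (Set.range fun f : A ↪[L] M => χ (w.comp f)).ncard ≤ n

/-- Every structure in the age of `M` has a finite big Ramsey degree in `M`. -/
def HasFiniteBigRamseyDegrees (L : FirstOrder.Language.{u, v}) (M : Type w) [L.Structure M] : Prop :=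
  ∀ A : Bundled.{w} L.Structure, A ∈ L.age M → ∃ n : ℕ, 0 < n ∧ BigRamseyDegreeLE L A M n

/-! ### The category `Fin(M)` -/

/-- `Fin(M)`: the set of all finite nonempty (induced) substructures of `M`. -/
structure FinSub (L : FirstOrder.Language.{u, v}) (M : Type w) [L.Structure M] where
  toSub : L.Substructure M
  finite : (toSub : Set M).Finite
  nonempty : (toSub : Set M).Nonempty

section

variable {L : FirstOrder.Language.{u, v}} {M : Type w} [L.Structure M]

/-- `Emb(A, B)` for `A, B ∈ Fin(M)`. -/
abbrev FinSub.Emb (A B : FinSub L M) : Type w := A.toSub ↪[L] B.toSub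

/-- `Emb(A, M)` for `A ∈ Fin(M)`. -/
abbrev FinSub.EmbInto (A : FinSub L M) : Type w := A.toSub ↪[L] M

/-- `Fin(M)` as a category with embeddings as morphisms. -/
instance : Category (FinSub L M) where
  Hom A B := FinSub.Emb A B
  id A := FirstOrder.Language.Embedding.refl L A.toSub
  comp f g := FirstOrder.Language.Embedding.comp g f

/-- The embedding underlying a morphism of `Fin(M)`. -/
def FinSub.toEmb {A B : FinSub L M} (f : A ⟶ B) : FinSub.Emb A B := f

/-- `⋃_{C ∈ Fin(M)} Emb(A, C)`, a disjoint union: an element records its codomain. -/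
abbrev FinSub.EmbUnion (A : FinSub L M) : Type w := Σ C : FinSub L M, FinSub.Emb A C

/-- Precomposition of an element of `⋃_C Emb(B, C)` with an embedding `A ↪ B`. -/
def FinSub.EmbUnion.precomp {A B : FinSub L M} (x : FinSub.EmbUnion B) (f : FinSub.Emb A B) :
    FinSub.EmbUnion A :=
  ⟨x.1, x.2.comp f⟩

end

/-- `M` (equivalently `Fin(M)`) has natural 1-point extensions. -/
def HasNaturalOnePointExtensions (L : FirstOrder.Language.{u, v}) (M : Type w) [L.Structure M] : Prop :=
  ∃ J : FinSub L M ⥤ FinSub L M,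
    (∀ A : FinSub L M, A.toSub ≤ (J.obj A).toSub ∧
      ((J.obj A).toSub \ A.toSub : Set M).ncard = 1) ∧
    ∀ (A B : FinSub L M) (f : A ⟶ B),
      (∀ (a : A.toSub) (a' : (J.obj A).toSub), (a' : M) = (a : M) →
        (FinSub.toEmb (J.map f) a' : M) = (FinSub.toEmb f a : M)) ∧
      (fun x : (J.obj A).toSub => (FinSub.toEmb (J.map f) x : M)) '' {x | (x : M) ∉ A.toSub} =
        ((J.obj B).toSub \ B.toSub : Set M)

/-! ### Approximability and the `⋆`-operation -/

section

variable {L : FirstOrder.Language.{u, v}} {M : Type w} [L.Structure M]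

/-- `M` is approximable in `Fin(M)` via the object map `F` and the maps `Φ A`. Sets of embeddings
carry the discrete topology `⊥`, and `Φ A` has to be a Borel map. -/
structure IsApproximableVia (F : FinSub L M → FinSub L M)
    (Φ : ∀ A : FinSub L M, (F A).EmbInto → A.EmbUnion) : Prop where
  borel : ∀ (A C : FinSub L M) (O : Set (FinSub.Emb A C)), IsOpen[⊥] O →
    MeasurableSet[@borel (F A).EmbInto ⊥] {u | ∃ g ∈ O, Φ A u = ⟨C, g⟩}
  approx : ∀ (A B : FinSub L M) (f : FinSub.Emb A B) (u : (F B).EmbInto),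
    ∃ f' : FinSub.Emb (F A) (F B), Φ A (u.comp f') = (Φ B u).precomp f

/-- `h ⋆ f = Φ_B(h ∘ ι_{F(B)}) ∘ f`, for `h ∈ Emb(M, M)` and `f ∈ Emb(A, B)`. -/
def star (F : FinSub L M → FinSub L M) (Φ : ∀ A : FinSub L M, (F A).EmbInto → A.EmbUnion)
    (ι : ∀ B : FinSub L M, B.EmbInto) (h : M ↪[L] M) {A B : FinSub L M} (f : FinSub.Emb A B) :
    A.EmbUnion :=
  (Φ B (h.comp (ι (F B)))).precomp f

end

/-- `M` is approximable in `Fin(M)`. -/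
def IsApproximable (L : FirstOrder.Language.{u, v}) (M : Type w) [L.Structure M] : Prop :=
  ∃ (F : FinSub L M → FinSub L M) (Φ : ∀ A : FinSub L M, (F A).EmbInto → A.EmbUnion),
    IsApproximableVia F Φ

end EnumFraisse

open EnumFraisse

/-! Ultrahomogeneity and strong amalgamation let a finite partial embedding be extended to a new
point whose image avoids any given finite set (`IsPartialEmb.exists_update`). In order type ω, being
above finitely many points only excludes a finite set, so images can always be placed above those
points. For (a), the natural new points for `L` are moved above their structures; conjugating by
these moves keeps them natural, and top points respect the order. For (b), let F(A) be A with its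
new top point q, and send u to its restriction to A, with codomain the initial segment below u(q).
An extended embedding sends top point to top point, so the codomains agree. For (c), a
self-embedding of the reduct can be made increasing by precomposition, so finite big Ramsey degrees
survive the enumeration. Apply this to F(A) with the coloring u ↦ χ(Φ_A(u)). By approximability each
h ⋆ f equals Φ_A(h ∘ ι ∘ f') for some f', so its color is already counted. -/

namespace EnumFraisse

open FirstOrder.Language FirstOrder.Language.Structure

/-! ### Finite partial embeddings and one-point extension -/

section Partial

variable {L : FirstOrder.Language.{u, v}} {M : Type w} [L.Structure M]

/-- In a relational language every set carries a substructure. -/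
def setSub [L.IsRelational] (X : Set M) : L.Substructure M where
  carrier := X
  fun_mem := fun f => isEmptyElim f

variable (L) in
/-- `φ` is injective on `X` and preserves and reflects all relations on `X`. -/
def IsPartialEmb {N : Type*} [L.Structure N] (X : Set M) (φ : M → N) : Prop :=
  Set.InjOn φ X ∧ ∀ (n : ℕ) (R : L.Relations n) (v : Fin n → M), (∀ i, v i ∈ X) →
    (RelMap R (fun i => φ (v i)) ↔ RelMap R v)

theorem IsPartialEmb.congr {N : Type*} [L.Structure N] {X : Set M} {φ ψ : M → N}
    (h : IsPartialEmb L X φ) (e : Set.EqOn φ ψ X) : IsPartialEmb L X ψ := by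
  refine ⟨h.1.congr e, fun n R v hv => ?_⟩
  rw [← h.2 n R v hv]
  have : (fun i => ψ (v i)) = fun i => φ (v i) := funext fun i => (e (hv i)).symm
  rw [this]

theorem IsPartialEmb.comp {N P : Type*} [L.Structure N] [L.Structure P] {X : Set M} {Y : Set N}
    {φ : M → N} {ψ : N → P} (hψ : IsPartialEmb L Y ψ) (hφ : IsPartialEmb L X φ)
    (h : Set.MapsTo φ X Y) : IsPartialEmb L X (ψ ∘ φ) :=
  ⟨hψ.1.comp hφ.1 h, fun n R v hv =>
    (hψ.2 n R _ fun i => h (hv i)).trans (hφ.2 n R v hv)⟩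

/-- Lets a partial embedding be cancelled on the right; used to transfer naturality from the old new
points to the moved ones. -/
theorem IsPartialEmb.of_comp {N P : Type*} [L.Structure N] [L.Structure P] {X : Set M}
    {φ : M → N} {ψ : N → P} (h : IsPartialEmb L X (ψ ∘ φ)) (hφ : IsPartialEmb L X φ) :
    IsPartialEmb L (φ '' X) ψ := by
  constructor
  · rintro _ ⟨x, hx, rfl⟩ _ ⟨y, hy, rfl⟩ e
    rw [h.1 hx hy e]
  · intro n R v hv
    choose x hx hxv using hv
    obtain rfl : (fun i => φ (x i)) = v := funext hxv
    exact (h.2 n R x hx).trans (hφ.2 n R x hx).symm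

theorem IsPartialEmb.id (X : Set M) : IsPartialEmb L X id :=
  ⟨Function.injective_id.injOn, fun _ _ _ _ => Iff.rfl⟩

/-- A partial embedding as an embedding of substructures. -/
def IsPartialEmb.toEmb [L.IsRelational] {N : Type*} [L.Structure N] {X : L.Substructure M}
    {Y : L.Substructure N} {φ : M → N} (h : IsPartialEmb L (X : Set M) φ)
    (hm : ∀ x ∈ X, φ x ∈ Y) : X ↪[L] Y where
  toFun x := ⟨φ x, hm x x.2⟩
  inj' x y e := Subtype.ext (h.1 x.2 y.2 (congrArg Subtype.val e))
  map_fun' f := isEmptyElim f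
  map_rel' {n} R v := h.2 n R (fun i => (v i : M)) fun i => (v i).2

theorem isPartialEmb_of_embedding {N : Type*} [L.Structure N] {X : L.Substructure M}
    (f : X ↪[L] N) {φ : M → N} (h : ∀ x : X, φ x = f x) : IsPartialEmb L (X : Set M) φ := by
  constructor
  · intro x hx y hy e
    have := h ⟨x, hx⟩ ▸ h ⟨y, hy⟩ ▸ e
    exact congrArg Subtype.val (f.injective this)
  · intro n R v hv
    have := f.map_rel R fun i => (⟨v i, hv i⟩ : X)
    have e : (fun i => φ (v i)) = f ∘ fun i => (⟨v i, hv i⟩ : X) :=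
      funext fun i => h ⟨v i, hv i⟩
    rw [e, this]
    rfl

theorem isPartialEmb_coe_of_embedding {N : Type*} [L.Structure N] {X : L.Substructure M}
    {Y : L.Substructure N} (f : X ↪[L] Y) {φ : M → N} (h : ∀ x : X, φ x = f x) :
    IsPartialEmb L (X : Set M) φ :=
  isPartialEmb_of_embedding (Y.subtype.comp f) h

theorem setSub_mem_age [L.IsRelational] {X : Set M} (hX : X.Finite) :
    (⟨setSub (L := L) X, inferInstance⟩ : Bundled.{w} L.Structure) ∈ L.age M := by
  have : Finite (setSub (L := L) X) := hX
  exact ⟨(Substructure.fg_iff_structure_fg _).1 Substructure.FG.of_finite,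
    ⟨Substructure.subtype _⟩⟩

/-- In an ultrahomogeneous structure with strongly amalgamable age, a finite partial embedding
extends to one more point with a value outside any given finite set. -/
theorem IsPartialEmb.exists_update [L.IsRelational] [DecidableEq M] (hu : L.IsUltrahomogeneous M)
    (hA : StrongAmalgamation (L.age M)) {X T : Set M} (hX : X.Finite) (hT : T.Finite)
    {φ : M → M} (hφ : IsPartialEmb L X φ) {x : M} (hx : x ∉ X) :
    ∃ y ∉ T, IsPartialEmb L (insert x X) (Function.update φ x y) := by
  let f : setSub (L := L) X ↪[L] setSub (L := L) (insert x X) :=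
    Substructure.inclusion fun _ h => Set.mem_insert_of_mem _ h
  let g : setSub (L := L) X ↪[L] setSub (L := L) (φ '' X ∪ T) :=
    IsPartialEmb.toEmb (X := setSub X) hφ fun z hz => Or.inl ⟨z, hz, rfl⟩
  -- Putting `T` into the second factor makes strongness of the amalgam keep `x` away from `T`.
  obtain ⟨D, f', g', hD, hcomm, hrange⟩ := hA
    ⟨setSub X, inferInstance⟩ ⟨setSub (insert x X), inferInstance⟩
    ⟨setSub (φ '' X ∪ T), inferInstance⟩ f g (setSub_mem_age hX)
    (setSub_mem_age (hX.insert x)) (setSub_mem_age ((hX.image φ).union hT))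
  have : Nonempty (D ↪[L] M) := hD.2
  -- Realize the amalgam inside `M` so that the second factor stays pointwise fixed.
  obtain ⟨e, he⟩ := hu.extend_embedding (setSub_mem_age (L := L) ((hX.image φ).union hT)).1
    (Substructure.subtype _) g'
  have he' : ∀ c : setSub (L := L) (φ '' X ∪ T), e (g' c) = c := fun c =>
    (DFunLike.congr_fun he c).symm
  let x' : setSub (L := L) (insert x X) := ⟨x, Set.mem_insert _ _⟩
  refine ⟨e (f' x'), fun hy => ?_, ?_⟩
  · have h1 : f' x' = g' ⟨e (f' x'), Or.inr hy⟩ := e.injective (he' ⟨e (f' x'), Or.inr hy⟩).symm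
    have h2 : f' x' ∈ Set.range (f'.comp f) := hrange ▸ ⟨⟨x', rfl⟩, ⟨_, h1.symm⟩⟩
    obtain ⟨a, ha⟩ := h2
    have h3 : f a = x' := f'.injective ha
    have h4 : (a : M) = x := congrArg Subtype.val h3
    exact hx (h4 ▸ a.2)
  · refine isPartialEmb_of_embedding (X := setSub (insert x X)) (e.comp f') ?_
    rintro ⟨z, hz⟩
    rcases eq_or_ne z x with rfl | hne
    · simp [x']
    · have hz' : z ∈ X := hz.resolve_left hne
      rw [Function.update_of_ne hne]
      have h1 : f' (f ⟨z, hz'⟩) = g' (g ⟨z, hz'⟩) := DFunLike.congr_fun hcomm ⟨z, hz'⟩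
      have h2 := he' (g ⟨z, hz'⟩)
      rw [← h1] at h2
      exact h2.symm

end Partial

/-! ### Order-preserving embeddings and big Ramsey degrees of the enumeration -/

section Enumerated

variable {L : FirstOrder.Language.{u, v}} {S : Type w} [L.Structure S] [LinearOrder S]

instance : ltLanguage.IsRelational := fun _ => inferInstanceAs (IsEmpty Empty)

theorem finite_Iic_of_orderIso (e : S ≃o ℕ) (s : S) : (Set.Iic s).Finite := by
  have h : (e ⁻¹' Set.Iic (e s)).Finite := (Set.finite_Iic _).preimage e.injective.injOn
  simpa using h

theorem isPartialEmb_withLt_iff {X : Set S} {φ : S → S} :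
    IsPartialEmb (withLt L) X φ ↔ IsPartialEmb L X φ ∧ StrictMonoOn φ X := by
  constructor
  · intro h
    refine ⟨⟨h.1, fun n R v hv => h.2 n (Sum.inl R) v hv⟩, fun x hx y hy hxy => ?_⟩
    exact (h.2 2 (Sum.inr LtRel.lt) ![x, y] (by simp [Fin.forall_fin_two, hx, hy])).2 hxy
  · rintro ⟨h, hlt⟩
    refine ⟨h.1, fun n R v hv => ?_⟩
    rcases R with R | R
    · exact h.2 n R v hv
    · cases R
      exact hlt.lt_iff_lt (hv 0) (hv 1)

variable [L.IsRelational]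

/-- The embedding of the enumerated structure given by an order preserving embedding. -/
def ltEmbedding (w : S ↪[L] S) (hw : StrictMono w) : S ↪[withLt L] S where
  toFun := w
  inj' := w.injective
  map_fun' f := isEmptyElim f
  map_rel' {n} R v := by
    rcases R with R | R
    · exact w.map_rel R v
    · cases R
      exact hw.lt_iff_lt

/-- Any self-embedding can be composed with one such that the result is order preserving. -/
theorem exists_strictMono_comp (e : S ≃o ℕ) (hu : L.IsUltrahomogeneous S)
    (hA : StrongAmalgamation (L.age S)) (w : S ↪[L] S) :
    ∃ v : S ↪[L] S, StrictMono (w.comp v) := by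
  let X : ℕ → Set S := fun n => {s | e s < n}
  have hXfin : ∀ n, (X n).Finite := fun n => (Set.finite_Iio n).preimage e.injective.injOn
  have hXmono : ∀ {m n}, m ≤ n → X m ⊆ X n := fun h s hs => lt_of_lt_of_le hs h
  let P : ℕ → (S → S) → Prop := fun n φ =>
    IsPartialEmb L (X n) φ ∧ StrictMonoOn (fun s => w (φ s)) (X n)
  have step : ∀ n (φ : {φ // P n φ}), ∃ ψ : {φ // P (n + 1) φ},
      Set.EqOn φ.1 ψ.1 (X n) := by
    rintro n ⟨φ, hφ, hmono⟩
    have hx : e.symm n ∉ X n := by simp [X]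
    -- The forbidden values are those whose `w`-image fails to exceed some earlier one.
    have hT : (⋃ a ∈ X n, w ⁻¹' Set.Iic (w (φ a))).Finite :=
      (hXfin n).biUnion fun a _ => (finite_Iic_of_orderIso e _).preimage w.injective.injOn
    obtain ⟨y, hy, h⟩ := hφ.exists_update hu hA (hXfin n) hT hx
    have hX : X (n + 1) = insert (e.symm n) (X n) := by
      ext s
      simp only [X, Set.mem_ofPred_eq, Set.mem_insert_iff, Nat.lt_succ_iff_lt_or_eq]
      rw [or_comm, OrderIso.eq_symm_apply]
    have heq : Set.EqOn φ (Function.update φ (e.symm n) y) (X n) := fun s hs =>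
      (Function.update_of_ne (fun (h : s = e.symm n) => hx (h ▸ hs)) _ _).symm
    refine ⟨⟨Function.update φ (e.symm n) y, hX ▸ h, ?_⟩, heq⟩
    have hle : ∀ s ∈ X (n + 1), ∀ t ∈ X (n + 1), s < t → s ∈ X n := by
      intro s _ t ht hst
      have h1 : e s < e t := e.lt_iff_lt.2 hst
      have h2 : e t < n + 1 := ht
      change e s < n
      omega
    intro s hs t ht hst
    have hsn := hle s hs t ht hst
    rw [hX] at ht
    rcases ht with rfl | ht
    · simp only [← heq hsn, Function.update_self]
      by_contra hc
      exact hy (Set.mem_biUnion hsn (not_lt.1 hc))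
    · simp only [← heq hsn, ← heq ht]
      exact hmono hsn ht hst
  choose next hnext using step
  let seq : ∀ n, {φ // P n φ} := fun n => Nat.rec
    ⟨id, (IsPartialEmb.id _), fun s hs => absurd hs (Nat.not_lt_zero _)⟩ next n
  have hseq : ∀ {m n}, m ≤ n → Set.EqOn (seq m).1 (seq n).1 (X m) := by
    intro m n hmn
    induction n, hmn using Nat.le_induction with
    | base => exact fun _ _ => rfl
    | succ n hmn ih => exact ih.trans ((hnext n (seq n)).mono (hXmono hmn))
  -- Stage `e s + 1` is the first whose domain contains `s`.
  let φ : S → S := fun s => (seq (e s + 1)).1 s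
  have hφ : ∀ n, Set.EqOn (seq n).1 φ (X n) := fun n s hs =>
    (hseq (Nat.succ_le_of_lt hs) (Nat.lt_succ_self (e s))).symm
  have hP : ∀ n, P n φ := fun n => ⟨(seq n).2.1.congr (hφ n),
    (seq n).2.2.congr fun s hs => congrArg w (hφ n hs)⟩
  have hlt : StrictMono fun s => w (φ s) := fun s t hst =>
    (hP (e t + 1)).2 (Nat.lt_succ_of_lt (e.lt_iff_lt.2 hst)) (Nat.lt_succ_self _) hst
  refine ⟨⟨⟨φ, fun s t h => hlt.injective (congrArg w h)⟩, fun f => isEmptyElim f, ?_⟩, hlt⟩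
  intro n R v
  exact (hP (Finset.univ.sup (fun i => e (v i)) + 1)).1.2 n R v fun i =>
    Nat.lt_succ_of_le (Finset.le_sup (f := fun i => e (v i)) (Finset.mem_univ i))

/-- The structure obtained by forgetting the order. -/
def FinSub.forgetLt (A : FinSub (withLt L) S) : FinSub L S :=
  ⟨setSub A.toSub, A.finite, A.nonempty⟩

/-- Passing to an enumeration preserves finiteness of big Ramsey degrees. -/
theorem exists_bigRamseyDegree_withLt (e : S ≃o ℕ) (hu : L.IsUltrahomogeneous S)
    (hA : StrongAmalgamation (L.age S)) (hT : HasFiniteBigRamseyDegrees L S)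
    (A : FinSub (withLt L) S) :
    ∃ n : ℕ, 0 < n ∧ BigRamseyDegreeLE (withLt L) A.toSub S n := by
  classical
  obtain ⟨n, hn, h⟩ := hT _ (setSub_mem_age (L := L) A.finite)
  refine ⟨n, hn, fun k χ => ?_⟩
  let lift : {f : setSub (L := L) (A.toSub : Set S) ↪[L] S //
      ∀ a b, a < b → f a < f b} → (A.toSub ↪[withLt L] S) := fun f =>
    { toFun := f.1
      inj' := f.1.injective
      map_fun' := fun f => isEmptyElim f
      map_rel' := fun {n} R v => by
        rcases R with R | R
        · exact f.1.map_rel R v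
        · cases R
          exact StrictMono.lt_iff_lt (f := f.1) (fun a b => f.2 a b) }
  -- The extra color absorbs embeddings of the reduct that are not increasing.
  obtain ⟨w, hw⟩ := h (k + 1) fun f =>
    if hf : ∀ a b, a < b → f a < f b then (χ (lift ⟨f, hf⟩)).castSucc else Fin.last k
  obtain ⟨v, hv⟩ := exists_strictMono_comp e hu hA w
  refine ⟨ltEmbedding (w.comp v) hv, le_trans ?_ hw⟩
  rw [← Set.ncard_image_of_injective _ (Fin.castSucc_injective k)]
  refine Set.ncard_le_ncard ?_ (Set.toFinite _)
  rintro _ ⟨_, ⟨f, rfl⟩, rfl⟩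
  let g : setSub (L := L) (A.toSub : Set S) ↪[L] S :=
    { toFun := f
      inj' := f.injective
      map_fun' := fun f => isEmptyElim f
      map_rel' := fun {n} R x => f.map_rel (Sum.inl R) x }
  have hg : ∀ a b, a < b → g a < g b := fun a b hab =>
    (f.map_rel (Sum.inr LtRel.lt) ![a, b]).2 hab
  refine ⟨v.comp g, ?_⟩
  have hwg : ∀ a b, a < b → (w.comp (v.comp g)) a < (w.comp (v.comp g)) b :=
    fun a b hab => hv (hg a b hab)
  simp only [dif_pos hwg]
  rfl

end Enumerated

/-! ### Natural one-point extensions as natural choices of points -/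

section OnePoint

variable {L : FirstOrder.Language.{u, v}} {M : Type w} [L.Structure M]

open Classical in
/-- The map extending `f` by the constant value `q`. -/
noncomputable def FinSub.Emb.ext {A B : FinSub L M} (f : FinSub.Emb A B) (q : M) (x : M) : M :=
  if h : x ∈ A.toSub then f ⟨x, h⟩ else q

theorem FinSub.Emb.ext_of_mem {A B : FinSub L M} (f : FinSub.Emb A B) (q : M) {x : M}
    (h : x ∈ A.toSub) : f.ext q x = f ⟨x, h⟩ := dif_pos h

theorem FinSub.Emb.ext_of_notMem {A B : FinSub L M} (f : FinSub.Emb A B) (q : M) {x : M}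
    (h : x ∉ A.toSub) : f.ext q x = q := dif_neg h

/-- A choice of new points which is natural: every embedding extends to the new points. -/
structure IsNaturalPoint (p : FinSub L M → M) : Prop where
  notMem : ∀ A, p A ∉ A.toSub
  isPartialEmb : ∀ {A B : FinSub L M} (f : FinSub.Emb A B),
    IsPartialEmb L (insert (p A) (A.toSub : Set M)) (f.ext (p B))

theorem HasNaturalOnePointExtensions.exists_isNaturalPoint
    (h : HasNaturalOnePointExtensions L M) : ∃ p : FinSub L M → M, IsNaturalPoint p := by
  obtain ⟨J, hJ, hmap⟩ := h
  choose p hp using fun A => Set.ncard_eq_one.1 (hJ A).2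
  have hmem : ∀ A, p A ∈ (J.obj A).toSub ∧ p A ∉ A.toSub := fun A => by
    have : p A ∈ ((J.obj A).toSub \ A.toSub : Set M) := hp A ▸ rfl
    exact this
  have hins : ∀ A, (insert (p A) (A.toSub : Set M)) = (J.obj A).toSub := fun A => by
    rw [← Set.singleton_union, ← hp A, Set.sdiff_union_of_subset (hJ A).1]
  refine ⟨p, fun A => (hmem A).2, fun {A B} f => ?_⟩
  obtain ⟨h1, h2⟩ := hmap A B f
  rw [hins]
  refine isPartialEmb_coe_of_embedding (FinSub.toEmb (J.map f)) fun x => ?_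
  by_cases hx : (x : M) ∈ A.toSub
  · rw [FinSub.Emb.ext_of_mem _ _ hx]
    exact (h1 ⟨x, hx⟩ x rfl).symm
  · rw [FinSub.Emb.ext_of_notMem _ _ hx]
    have : (FinSub.toEmb (J.map f) x : M) ∈ ((J.obj B).toSub \ B.toSub : Set M) :=
      h2 ▸ ⟨x, hx, rfl⟩
    rw [hp B] at this
    exact this.symm

theorem FinSub.EmbUnion.ext' {A : FinSub L M} {x y : A.EmbUnion} (h : x.1 = y.1)
    (h' : ∀ a, (x.2 a : M) = y.2 a) : x = y := by
  obtain ⟨C, f⟩ := x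
  obtain ⟨D, g⟩ := y
  obtain rfl : C = D := h
  congr 1
  exact FirstOrder.Language.Embedding.ext fun a => Subtype.ext (h' a)

variable [L.IsRelational] {p : FinSub L M → M}

/-- The structure `A` together with its new point. -/
def FinSub.insertPoint (p : FinSub L M → M) (A : FinSub L M) : FinSub L M :=
  ⟨setSub (insert (p A) (A.toSub : Set M)), A.finite.insert _, Set.insert_nonempty _ _⟩

/-- The extension of an embedding to the new points. -/
noncomputable def IsNaturalPoint.map (hp : IsNaturalPoint p) {A B : FinSub L M}
    (f : FinSub.Emb A B) : FinSub.Emb (A.insertPoint p) (B.insertPoint p) :=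
  IsPartialEmb.toEmb (X := (A.insertPoint p).toSub) (hp.isPartialEmb f) <| by
    intro x _
    by_cases h : x ∈ A.toSub
    · exact Or.inr (f.ext_of_mem _ h ▸ (f ⟨x, h⟩).2)
    · exact Or.inl (f.ext_of_notMem _ h)

theorem IsNaturalPoint.map_coe (hp : IsNaturalPoint p) {A B : FinSub L M}
    (f : FinSub.Emb A B) (x : (A.insertPoint p).toSub) :
    (hp.map f x : M) = f.ext (p B) x := rfl

/-- New points go to new points, so the extended maps compose and the functor laws can be checked
pointwise. -/
theorem IsNaturalPoint.hasNaturalOnePointExtensions (hp : IsNaturalPoint p) :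
    HasNaturalOnePointExtensions L M := by
  have hdiff : ∀ A, ((A.insertPoint p).toSub \ A.toSub : Set M) = {p A} := fun A => by
    ext x
    constructor
    · rintro ⟨h, h'⟩
      exact h.resolve_right h'
    · rintro rfl
      exact ⟨Or.inl rfl, hp.notMem A⟩
  refine ⟨{ obj := FinSub.insertPoint p
            map := fun f => hp.map f
            map_id := fun A => ?_
            map_comp := fun {A B C} f g => ?_ }, fun A => ⟨?_, ?_⟩, fun A B f => ⟨?_, ?_⟩⟩
  · refine FirstOrder.Language.Embedding.ext fun x => Subtype.ext ?_
    rw [IsNaturalPoint.map_coe]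
    by_cases h : (x : M) ∈ A.toSub
    · exact FinSub.Emb.ext_of_mem _ _ h
    · exact (FinSub.Emb.ext_of_notMem _ _ h).trans (x.2.resolve_right h).symm
  · refine FirstOrder.Language.Embedding.ext fun x => Subtype.ext ?_
    change FinSub.Emb.ext (FinSub.toEmb (f ≫ g)) (p C) x =
      FinSub.Emb.ext (FinSub.toEmb g) (p C) (FinSub.Emb.ext (FinSub.toEmb f) (p B) x)
    by_cases h : (x : M) ∈ A.toSub
    · rw [FinSub.Emb.ext_of_mem _ _ h, FinSub.Emb.ext_of_mem _ _ h,
        FinSub.Emb.ext_of_mem _ _ (FinSub.toEmb f ⟨x, h⟩).2]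
      rfl
    · rw [FinSub.Emb.ext_of_notMem _ _ h, FinSub.Emb.ext_of_notMem _ _ h,
        FinSub.Emb.ext_of_notMem _ _ (hp.notMem B)]
  · exact fun x hx => Or.inr hx
  · rw [Set.ncard_eq_one]
    exact ⟨p A, hdiff A⟩
  · rintro a ⟨_, h⟩ rfl
    exact FinSub.Emb.ext_of_mem _ _ a.2
  · refine Eq.trans ?_ (hdiff B).symm
    ext y
    constructor
    · rintro ⟨x, hx, rfl⟩
      exact FinSub.Emb.ext_of_notMem _ _ hx
    · rintro rfl
      exact ⟨⟨p A, Or.inl rfl⟩, hp.notMem A, FinSub.Emb.ext_of_notMem _ _ (hp.notMem A)⟩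

end OnePoint

/-! ### New points on top, and approximability -/

section Enumerated

variable {L : FirstOrder.Language.{u, v}} [L.IsRelational] {S : Type w} [L.Structure S]
  [LinearOrder S]

/-- Natural new points can be chosen above the structures they are added to. -/
theorem exists_isNaturalPoint_withLt (e : S ≃o ℕ) (hu : L.IsUltrahomogeneous S)
    (hA : StrongAmalgamation (L.age S)) (hJ : HasNaturalOnePointExtensions L S) :
    ∃ q : FinSub (withLt L) S → S, IsNaturalPoint q ∧ ∀ A, ∀ a ∈ A.toSub, a < q A := by
  obtain ⟨p, hp⟩ := hJ.exists_isNaturalPoint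
  have key : ∀ A : FinSub (withLt L) S, ∃ y, (∀ a ∈ A.toSub, a < y) ∧
      IsPartialEmb L (insert (p A.forgetLt) (A.toSub : Set S))
        (Function.update id (p A.forgetLt) y) := by
    intro A
    obtain ⟨y, hy, h⟩ := (IsPartialEmb.id (L := L) (A.toSub : Set S)).exists_update hu hA
      A.finite (A.finite.biUnion fun a _ => finite_Iic_of_orderIso e a) (hp.notMem A.forgetLt)
    exact ⟨y, fun a ha => not_le.1 fun hc => hy (Set.mem_biUnion ha hc), h⟩
  choose q hlt hq using key
  have hnot : ∀ A, q A ∉ A.toSub := fun A h => lt_irrefl _ (hlt A _ h)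
  refine ⟨q, ⟨hnot, fun {A B} f => ?_⟩, hlt⟩
  rw [isPartialEmb_withLt_iff]
  constructor
  · let f' : FinSub.Emb A.forgetLt B.forgetLt :=
      { toFun := f
        inj' := f.injective
        map_fun' := fun f => isEmptyElim f
        map_rel' := fun {n} R x => f.map_rel (Sum.inl R) x }
    have hne : ∀ {A : FinSub (withLt L) S} {x}, x ∈ A.toSub → x ≠ p A.forgetLt :=
      fun {A x} hx h => hp.notMem A.forgetLt (h ▸ hx)
    have h1 := (hq B).comp (hp.isPartialEmb f') <| by
      rintro x (rfl | hx)
      · exact Or.inl (f'.ext_of_notMem _ (hp.notMem _))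
      · exact Or.inr (f'.ext_of_mem _ hx ▸ (f' ⟨x, hx⟩).2)
    -- The square relating the extension of `f` at the old points to that at the moved points
    -- commutes.
    have h2 : Set.EqOn (Function.update id (p B.forgetLt) (q B) ∘ f'.ext (p B.forgetLt))
        (f.ext (q B) ∘ Function.update id (p A.forgetLt) (q A))
        (insert (p A.forgetLt) (A.toSub : Set S)) := by
      rintro x (rfl | hx)
      · simp only [Function.comp_apply, Function.update_self]
        rw [f'.ext_of_notMem _ (hp.notMem _), f.ext_of_notMem _ (hnot A), Function.update_self]
      · simp only [Function.comp_apply]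
        rw [f'.ext_of_mem _ hx, Function.update_of_ne (hne hx), id, f.ext_of_mem _ hx,
          Function.update_of_ne (hne (f' ⟨x, hx⟩).2)]
        rfl
    have h3 : IsPartialEmb L (Function.update id (p A.forgetLt) (q A) ''
        insert (p A.forgetLt) (A.toSub : Set S)) (f.ext (q B)) := (h1.congr h2).of_comp (hq A)
    have h4 : Function.update id (p A.forgetLt) (q A) ''
        insert (p A.forgetLt) (A.toSub : Set S) = insert (q A) (A.toSub : Set S) := by
      rw [Set.image_insert_eq, Function.update_self]
      congr 1
      refine (Set.EqOn.image_eq fun x hx => Function.update_of_ne (hne hx) _ _).trans ?_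
      exact Set.image_id _
    rwa [h4] at h3
  · rintro x hx y hy hxy
    have hxA : x ∈ A.toSub := by
      rcases hx with rfl | hx
      · rcases hy with rfl | hy
        · exact absurd hxy (lt_irrefl _)
        · exact absurd hxy (hlt A y hy).not_gt
      · exact hx
    rw [f.ext_of_mem _ hxA]
    rcases hy with rfl | hy
    · rw [f.ext_of_notMem _ (hnot A)]
      exact hlt B _ (f ⟨x, hxA⟩).2
    · rw [f.ext_of_mem _ hy]
      exact (f.map_rel (Sum.inr LtRel.lt) ![⟨x, hxA⟩, ⟨y, hy⟩]).2 hxy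

/-- The finite substructure on a proper initial segment. -/
def initialSegment (e : S ≃o ℕ) (s : S) (h : ∃ t, t < s) : FinSub (withLt L) S :=
  ⟨setSub (Set.Iio s), (finite_Iic_of_orderIso e s).subset Set.Iio_subset_Iic_self, h⟩

/-- The image of the top point determines the codomain, and it is unchanged when `u` is precomposed
with the extension of `f`. -/
theorem isApproximable_of_isNaturalPoint (e : S ≃o ℕ) {q : FinSub (withLt L) S → S}
    (hq : IsNaturalPoint q) (hlt : ∀ A, ∀ a ∈ A.toSub, a < q A) :
    IsApproximable (withLt L) S := by
  let top : ∀ A : FinSub (withLt L) S, (A.insertPoint q).toSub := fun A => ⟨q A, Or.inl rfl⟩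
  let inc : ∀ A : FinSub (withLt L) S, A.toSub ↪[withLt L] (A.insertPoint q).toSub :=
    fun A => Substructure.inclusion fun _ h => Or.inr h
  have hlt' : ∀ (A : FinSub (withLt L) S) (u : (A.insertPoint q).EmbInto) (a : A.toSub),
      u (inc A a) < u (top A) := fun A u a =>
    (u.map_rel (Sum.inr LtRel.lt) ![inc A a, top A]).2 (hlt A a a.2)
  -- Nonemptiness of `A` makes the initial segment a legitimate object.
  have hex : ∀ (A : FinSub (withLt L) S) (u : (A.insertPoint q).EmbInto),
      ∃ t, t < u (top A) := fun A u =>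
    ⟨_, hlt' A u ⟨A.nonempty.choose, A.nonempty.choose_spec⟩⟩
  let Φ : ∀ A : FinSub (withLt L) S, (A.insertPoint q).EmbInto → A.EmbUnion := fun A u =>
    ⟨initialSegment e (u (top A)) (hex A u),
      (u.comp (inc A)).codRestrict _ fun a => hlt' A u a⟩
  refine ⟨FinSub.insertPoint q, Φ, ⟨fun A C O _ => ?_, fun A B f u => ⟨hq.map f, ?_⟩⟩⟩
  · exact MeasurableSpace.measurableSet_generateFrom trivial
  · have htop : hq.map f (top A) = top B :=
      Subtype.ext (f.ext_of_notMem _ (hq.notMem A))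
    have hinc : ∀ a, hq.map f (inc A a) = inc B (f a) := fun a =>
      Subtype.ext (f.ext_of_mem _ a.2)
    refine FinSub.EmbUnion.ext' ?_ fun a => ?_
    · change initialSegment e (u (hq.map f (top A))) _ = initialSegment e (u (top B)) _
      congr 2
    · exact congrArg u (hinc a)

end Enumerated

end EnumFraisse

theorem mainTheorem2 {L : FirstOrder.Language.{u, v}} [L.IsRelational]
    {S : Type w} [L.Structure S] [LinearOrder S]
    (hω : Nonempty (S ≃o ℕ))
    (hF : IsFraisseLimitOfAge L S)
    (hT : HasFiniteBigRamseyDegrees L S)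
    (hA : StrongAmalgamation (L.age S))
    (hJ : HasNaturalOnePointExtensions L S) :
    HasNaturalOnePointExtensions (withLt L) S ∧
    IsApproximable (withLt L) S ∧
    ∀ (F : FinSub (withLt L) S → FinSub (withLt L) S)
      (Φ : ∀ A : FinSub (withLt L) S, (F A).EmbInto → A.EmbUnion),
      IsApproximableVia F Φ →
      ∀ (ι : ∀ B : FinSub (withLt L) S, B.EmbInto) (A : FinSub (withLt L) S),
        ∃ n : ℕ, 0 < n ∧ ∀ (k : ℕ) (χ : A.EmbUnion → Fin k),
          ∃ h : S ↪[withLt L] S,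
            (χ '' {x | ∃ (B : FinSub (withLt L) S) (f : FinSub.Emb A B),
              x = EnumFraisse.star F Φ ι h f}).ncard ≤ n := by
  obtain ⟨e⟩ := hω
  obtain ⟨q, hq, hlt⟩ := exists_isNaturalPoint_withLt e hF.ultrahomogeneous hA hJ
  refine ⟨hq.hasNaturalOnePointExtensions, isApproximable_of_isNaturalPoint e hq hlt, ?_⟩
  intro F Φ hΦ ι A
  obtain ⟨n, hn, h⟩ := exists_bigRamseyDegree_withLt e hF.ultrahomogeneous hA hT (F A)
  refine ⟨n, hn, fun k χ => ?_⟩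
  -- Pull the coloring back along `Φ A`; the bound depends only on `F A`.
  obtain ⟨w, hw⟩ := h k fun u => χ (Φ A u)
  refine ⟨w, le_trans (Set.ncard_le_ncard ?_ (Set.toFinite _)) hw⟩
  rintro _ ⟨_, ⟨B, f, rfl⟩, rfl⟩
  obtain ⟨f', hf'⟩ := hΦ.approx A B f (w.comp (ι (F B)))
  exact ⟨(ι (F B)).comp f', congrArg χ hf'⟩
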